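/- Let $d \ge 2$ and let $S^d$ be the unit sphere of $E^{d+1}$ with the spherical distance $|ab|$ (the angle between $a$ and $b$). A set $C \subset S^d$ is convex if it contains no pair of antipodes and contains, with any two of its points, the shorter great-circle arc connecting them; a convex body is a closed convex set with non-empty interior in $S^d$. A hemisphere $K$ (a closed ball of radius $\pi/2$) supports a convex body $C$ if $C \subset K$ and ${\rm bd}(C) \cap {\rm bd}(K) \neq \emptyset$. If hemispheres $G$ and $H$ are different and not opposite, $G \cap H$ is a lune, and its thickness is the spherical distance between the centers of the two $(d-1)$-dimensional hemispheres ${\rm bd}(G)\cap H$ and ${\rm bd}(H)\cap G$ bounding it. For a hemisphere $K$ supporting $C$, the width ${\rm width}_K(C)$ is the smallest thickness of a lune $K \cap K'$ over all hemispheres $K'$ supporting $C$ that form a lune with $K$. The body $C$ is of constant width $w$ if ${\rm width}_K(C) = w$ for every hemisphere $K$ supporting $C$. Theorem. If $W \subset S^d$ is a body of constant width $w$, then ${\rm diam}(W) = w$, where ${\rm diam}(W) = \max_{a,b \in W} |ab|$ is the diameter with respect to the spherical distance. -/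

import Mathlib

noncomputable section

namespace SphericalConvex

/-- The unit sphere `S^d` of the Euclidean space `E^(d+1)`, with the subspace topology. -/
abbrev Sph (d : ℕ) : Type := Metric.sphere (0 : EuclideanSpace ℝ (Fin (d + 1))) 1

variable {d : ℕ}

/-- The spherical distance `|ab|`: the length of the arc joining `a` and `b`, that is, the angle
between the unit vectors `a` and `b` (it is `0` for coinciding points, `π` for antipodes). -/
def sdist (a b : Sph d) : ℝ :=
  InnerProductGeometry.angle (a : EuclideanSpace ℝ (Fin (d + 1))) b

/-- The arc `ab`, for `a`, `b` which are not antipodes: the shorter part of the great circle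
through `a` and `b`, consisting of the points of the sphere in the cone spanned by `a`, `b`. -/
def arc (a b : Sph d) : Set (Sph d) :=
  {x | ∃ s t : ℝ, 0 ≤ s ∧ 0 ≤ t ∧
    (x : EuclideanSpace ℝ (Fin (d + 1))) =
      s • (a : EuclideanSpace ℝ (Fin (d + 1))) + t • (b : EuclideanSpace ℝ (Fin (d + 1)))}

/-- A set on the sphere is convex if it contains no pair of antipodes and contains, with any two
of its points, the arc connecting them. -/
def IsConvex (C : Set (Sph d)) : Prop :=
  (∀ x ∈ C, -x ∉ C) ∧ ∀ a ∈ C, ∀ b ∈ C, arc a b ⊆ C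

/-- A convex body: a closed convex set with non-empty interior (in the sphere). -/
structure IsConvexBody (C : Set (Sph d)) : Prop where
  convex : IsConvex C
  closed : IsClosed C
  interior_nonempty : (interior C).Nonempty

/-- The hemisphere `H(m)` with center `m`. -/
def hemisphere (m : Sph d) : Set (Sph d) := {x | sdist x m ≤ Real.pi / 2}

/-- The hemisphere with center `k` supports `C`: it contains `C`, and the boundaries of `C` and
of the hemisphere have a common point. -/
def Supports (k : Sph d) (C : Set (Sph d)) : Prop :=
  C ⊆ hemisphere k ∧ (frontier C ∩ frontier (hemisphere k)).Nonempty

/-- The `(d-1)`-dimensional great sphere orthogonal to `n`. -/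
def greatSphere (n : Sph d) : Set (Sph d) :=
  {x | inner ℝ (n : EuclideanSpace ℝ (Fin (d + 1))) (x : EuclideanSpace ℝ (Fin (d + 1))) = 0}

/-- `A` is a `(d-1)`-dimensional hemisphere with center `c`: the set of points of a
`(d-1)`-dimensional great sphere through `c` at distance at most `π/2` from `c`. -/
def IsSubhemisphereWithCenter (A : Set (Sph d)) (c : Sph d) : Prop :=
  ∃ n : Sph d, c ∈ greatSphere n ∧ A = {x | x ∈ greatSphere n ∧ sdist x c ≤ Real.pi / 2}

/-- The hemispheres with centers `g` and `h` are different and not opposite, so that their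
intersection is a lune. -/
def FormLune (g h : Sph d) : Prop := g ≠ h ∧ g ≠ -h

/-- For `G = H(g)` and `H = H(h)`, the part `G/H` of the boundary of the lune `G ∩ H` that lies in
the boundary of `G`. -/
def luneFace (g h : Sph d) : Set (Sph d) := frontier (hemisphere g) ∩ hemisphere h

/-- `t` is the thickness of the lune `G ∩ H`, where `G = H(g)` and `H = H(h)`: the spherical
distance of the centers of the `(d-1)`-dimensional hemispheres `G/H` and `H/G` bounding it. -/
def IsLuneThickness (g h : Sph d) (t : ℝ) : Prop :=
  FormLune g h ∧ ∃ a b : Sph d, IsSubhemisphereWithCenter (luneFace g h) a ∧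
    IsSubhemisphereWithCenter (luneFace h g) b ∧ t = sdist a b

/-- The width of `C` determined by its supporting hemisphere with center `k`: the smallest
thickness of a lune formed by this hemisphere and another hemisphere supporting `C`. -/
def width (k : Sph d) (C : Set (Sph d)) : ℝ :=
  sInf {t : ℝ | ∃ k' : Sph d, Supports k' C ∧ IsLuneThickness k k' t}

/-- `W` is a body of constant width `w`: a convex body whose width determined by every supporting
hemisphere equals `w`. -/
def IsBodyOfConstantWidth (W : Set (Sph d)) (w : ℝ) : Prop :=
  IsConvexBody W ∧ ∀ k : Sph d, Supports k W → width k W = w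

/-- The diameter of `C` with respect to the spherical distance. -/
def sdiam (C : Set (Sph d)) : ℝ :=
  sSup {t : ℝ | ∃ a ∈ C, ∃ b ∈ C, t = sdist a b}

end SphericalConvex

end

/-! The proof uses polarity in the ambient Euclidean space. The centers of the hemispheres
supporting `W` form `dualBoundary W`, and the lune of the hemispheres centered at `g` and `h` has
thickness `π` minus the angle between `g` and `h` (`isLuneThickness_iff`). With `c = -cos w`,
constant width therefore says that `⟪k, m⟫ ≥ c` on the dual boundary (`hA`), and that each `k` has
some `m` with equality (`hB`). It remains to see that the least inner product on `W` is `-c`.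

The value `-c` is attained (`exists_inner_eq_neg`): if `⟪k, m⟫ = c`, the normalized vectors `k - c
m` and `m - c k` are nonnegative on the dual body, hence lie in `W` by the bipolar theorem, and
their inner product is `-c`.

For the bound, let `a`, `b` be a diametral pair of `W`. Since `b` is farthest from `a`, the
normalized vector `p` of `a - ⟪a, b⟫ b` is in the dual boundary, and `⟪p, a⟫` is the sine of `|ab|`.
If `c < 0`, then `W` lies in a lune of thickness `w` with one side orthogonal to `p`, so this sine
is at most `sin w`; as `W` has no pair at obtuse distance, the bound follows
(`neg_le_inner_of_neg`). If `0 ≤ c`, the dual body is the intersection of the balls of radius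
`arccos c` about its boundary points (`mem_dualSet_of_forall_le`), which forces `c p + √(1 - c²) b`
into the dual body (`le_inner_smul_add_smul`); its inner product with `a` is then nonnegative, which
is the bound. -/

open scoped RealInnerProductSpace

namespace SphericalConvex

/-! ### Inner products of unit vectors; farthest points of convex sets. -/

section Polarity

variable {E : Type*} [NormedAddCommGroup E] [InnerProductSpace ℝ E]

/-- A spherical convex body, seen as a set of unit vectors. The last field replaces the condition
that the interior is non-empty. -/
structure IsUnitBody (W : Set E) : Prop where
  norm_eq : ∀ x ∈ W, ‖x‖ = 1
  compact : IsCompact W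
  nonempty : W.Nonempty
  neg_notMem : ∀ x ∈ W, -x ∉ W
  add_mem : ∀ a ∈ W, ∀ b ∈ W, ∀ s t : ℝ, 0 ≤ s → 0 ≤ t → ‖s • a + t • b‖ = 1 → s • a + t • b ∈ W
  exists_inner_ne : ∀ k : E, k ≠ 0 → ∃ x ∈ W, ⟪k, x⟫ ≠ 0

/-- The unit vectors in the dual cone of `W`. -/
def dualSet (W : Set E) : Set E := {k | ‖k‖ = 1 ∧ ∀ x ∈ W, 0 ≤ ⟪k, x⟫}

/-- The unit vectors in the dual cone of `W` which are orthogonal to some point of `W`. -/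
def dualBoundary (W : Set E) : Set E := {k | k ∈ dualSet W ∧ ∃ x ∈ W, ⟪k, x⟫ = 0}

theorem norm_inv_smul_self {z : E} (hz : z ≠ 0) : ‖‖z‖⁻¹ • z‖ = 1 := by
  rw [norm_smul, norm_inv, norm_norm, inv_mul_cancel₀ (norm_ne_zero_iff.2 hz)]

theorem norm_add_smul_sq {a b : E} (ha : ‖a‖ = 1) (hb : ‖b‖ = 1) (s t : ℝ) :
    ‖s • a + t • b‖ ^ 2 = s ^ 2 + 2 * s * t * ⟪a, b⟫ + t ^ 2 := by
  rw [norm_add_sq_real, norm_smul, norm_smul, ha, hb, real_inner_smul_left, real_inner_smul_right]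
  simp only [mul_one, Real.norm_eq_abs, sq_abs]
  ring

theorem norm_sub_smul_sq {a b : E} (ha : ‖a‖ = 1) (hb : ‖b‖ = 1) :
    ‖a - ⟪a, b⟫ • b‖ ^ 2 = 1 - ⟪a, b⟫ ^ 2 := by
  have := norm_add_smul_sq ha hb 1 (-⟪a, b⟫)
  rw [one_smul, neg_smul, ← sub_eq_add_neg] at this
  rw [this]; ring

theorem abs_inner_le_one {a b : E} (ha : ‖a‖ = 1) (hb : ‖b‖ = 1) : |⟪a, b⟫| ≤ 1 := by
  simpa [ha, hb] using abs_real_inner_le_norm a b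

theorem eq_of_inner_eq_one {a b : E} (ha : ‖a‖ = 1) (hb : ‖b‖ = 1) (h : ⟪a, b⟫ = 1) : a = b :=
  (inner_eq_one_iff_of_norm_eq_one ha hb).1 h

theorem eq_neg_of_inner_eq_neg_one {a b : E} (ha : ‖a‖ = 1) (hb : ‖b‖ = 1) (h : ⟪a, b⟫ = -1) :
    a = -b :=
  eq_of_inner_eq_one ha (by rwa [norm_neg]) (by rw [inner_neg_right, h, neg_neg])

theorem inner_sq_lt_one {a b : E} (ha : ‖a‖ = 1) (hb : ‖b‖ = 1) (h : a ≠ b) (h' : a ≠ -b) :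
    ⟪a, b⟫ ^ 2 < 1 := by
  have h1 := abs_le.1 (abs_inner_le_one ha hb)
  have h2 : ⟪a, b⟫ ≠ 1 := fun e => h (eq_of_inner_eq_one ha hb e)
  have h3 : ⟪a, b⟫ ≠ -1 := fun e => h' (eq_neg_of_inner_eq_neg_one ha hb e)
  have h4 := lt_of_le_of_ne h1.2 h2
  have h5 := lt_of_le_of_ne h1.1 h3.symm
  nlinarith

/-- If `y` is a point of the convex set `S` farthest from `k`, then `S` lies on one side of the
great sphere through `y` orthogonal to the arc `ky`. -/
theorem inner_mul_inner_le_of_forall_le {S : Set E} (hS : ∀ x ∈ S, ‖x‖ = 1)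
    (hadd : ∀ a ∈ S, ∀ b ∈ S, ∀ s t : ℝ, 0 ≤ s → 0 ≤ t → ‖s • a + t • b‖ = 1 → s • a + t • b ∈ S)
    {k y z : E} (hk : ‖k‖ = 1) (hy : y ∈ S) (hmin : ∀ x ∈ S, ⟪k, y⟫ ≤ ⟪k, x⟫) (hz : z ∈ S) :
    ⟪k, y⟫ * ⟪y, z⟫ ≤ ⟪k, z⟫ := by
  set c := ⟪k, y⟫ with hc
  set g := ⟪y, z⟫ with hg
  have hc1 := abs_le.1 (abs_inner_le_one hk (hS y hy))
  have hg1 := abs_le.1 (abs_inner_le_one (hS y hy) (hS z hz))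
  -- First-order comparison of `y` with the normalized `y + s • z`; after division by `s` the error
  -- is at most `s ≤ ε`.
  refine le_of_forall_pos_le_add fun ε hε => ?_
  obtain ⟨s, hs0, hs1, hsε⟩ : ∃ s : ℝ, 0 < s ∧ s < 1 ∧ s ≤ ε :=
    ⟨min ε (1 / 2), by positivity, by
      have := min_le_right ε (1 / 2); linarith, min_le_left _ _⟩
  have hN : ‖y + s • z‖ ^ 2 = 1 + 2 * s * g + s ^ 2 := by
    have := norm_add_smul_sq (hS y hy) (hS z hz) 1 s
    rw [one_smul] at this
    rw [this]; ring
  set N := ‖y + s • z‖ with hNdef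
  have hN0 : 0 ≤ N := norm_nonneg _
  have hNpos : 0 < N := by
    refine lt_of_le_of_ne hN0 fun h => ?_
    rw [← h] at hN
    nlinarith
  have hNe : N⁻¹ • y + (N⁻¹ * s) • z = N⁻¹ • (y + s • z) := by rw [smul_add, smul_smul]
  have hmem := hadd y hy z hz N⁻¹ (N⁻¹ * s) (by positivity) (by positivity) (by
    rw [hNe]; exact norm_inv_smul_self (norm_pos_iff.1 hNpos))
  have h1 := hmin _ hmem
  rw [hNe, real_inner_smul_right, inner_add_right, real_inner_smul_right, ← hc,
    le_inv_mul_iff₀ hNpos] at h1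
  have hlow : 1 + s * g ≤ N := by
    have hg2 : g ^ 2 ≤ 1 := by nlinarith
    refine le_of_abs_le (abs_le_of_sq_le_sq ?_ hN0)
    nlinarith [sq_nonneg s]
  have hup : N ≤ 1 + s * g + s ^ 2 := by
    have : 0 ≤ 1 + s * g := by nlinarith
    nlinarith [sq_nonneg (s * g), sq_nonneg s]
  have h2 : c * (1 + s * g) - s ^ 2 ≤ N * c := by
    rcases le_total 0 c with h | h <;> nlinarith
  have h3 : s * (c * g) ≤ s * (⟪k, z⟫ + s) := by nlinarith
  have := le_of_mul_le_mul_left h3 hs0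
  linarith

/-! ### The cone over a body, its dual cone and the bipolar theorem. -/

namespace IsUnitBody

variable {W : Set E}

theorem ne_zero (hW : IsUnitBody W) {x : E} (hx : x ∈ W) : x ≠ 0 :=
  norm_ne_zero_iff.1 (by rw [hW.norm_eq x hx]; exact one_ne_zero)

theorem inv_norm_smul_add_mem (hW : IsUnitBody W) {a b : E} (ha : a ∈ W) (hb : b ∈ W) {s t : ℝ}
    (hs : 0 ≤ s) (ht : 0 ≤ t) (h : s • a + t • b ≠ 0) :
    ‖s • a + t • b‖⁻¹ • (s • a + t • b) ∈ W := by
  have e : ‖s • a + t • b‖⁻¹ • (s • a + t • b) =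
      (‖s • a + t • b‖⁻¹ * s) • a + (‖s • a + t • b‖⁻¹ * t) • b := by
    rw [smul_add, smul_smul, smul_smul]
  have hn := norm_inv_smul_self h
  rw [e] at hn ⊢
  exact hW.add_mem a ha b hb _ _ (by positivity) (by positivity) hn

/-- The cone over a convex body. -/
def cone (W : Set E) : Set E := {z | ∃ x ∈ W, z = ‖z‖ • x}

theorem smul_mem_cone (hW : IsUnitBody W) {x : E} (hx : x ∈ W) {r : ℝ} (hr : 0 ≤ r) :
    r • x ∈ cone W :=
  ⟨x, hx, by rw [norm_smul, hW.norm_eq x hx, Real.norm_of_nonneg hr, mul_one]⟩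

theorem convex_cone (hW : IsUnitBody W) : Convex ℝ (cone W) := by
  rintro x ⟨a, ha, hxa⟩ y ⟨b, hb, hyb⟩ s t hs ht -
  have e : s • x + t • y = (s * ‖x‖) • a + (t * ‖y‖) • b := by
    rw [← smul_smul, ← smul_smul, ← hxa, ← hyb]
  rw [e]
  by_cases h : (s * ‖x‖) • a + (t * ‖y‖) • b = 0
  · rw [h]; exact ⟨a, ha, by simp⟩
  · refine ⟨_, hW.inv_norm_smul_add_mem ha hb (by positivity) (by positivity) h, ?_⟩
    rw [smul_smul, mul_inv_cancel₀ (norm_ne_zero_iff.2 h), one_smul]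

theorem isClosed_cone (hW : IsUnitBody W) : IsClosed (cone W) := by
  have : CompactSpace W := isCompact_iff_compactSpace.1 hW.compact
  have hcl : IsClosed {p : E × W | p.1 = ‖p.1‖ • (p.2 : E)} :=
    isClosed_eq (by fun_prop) (by fun_prop)
  have := isClosedMap_fst_of_compactSpace _ hcl
  convert this using 1
  ext z
  simp [cone]

/-- Hahn–Banach for a closed convex cone: a functional bounded below on the cone is nonnegative
there, since a negative value could be scaled down to the separating level `r`. -/
theorem exists_dual_neg [CompleteSpace E] (hW : IsUnitBody W) {u : E} (hu : u ∉ cone W) :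
    ∃ m : E, (∀ x ∈ W, 0 ≤ ⟪m, x⟫) ∧ ⟪m, u⟫ < 0 := by
  obtain ⟨f, r, hfu, hf⟩ := geometric_hahn_banach_point_closed hW.convex_cone hW.isClosed_cone hu
  obtain ⟨x₀, hx₀⟩ := hW.nonempty
  have hr : r < 0 := by
    simpa using hf 0 ⟨x₀, hx₀, by simp⟩
  refine ⟨(InnerProductSpace.toDual ℝ E).symm f, fun x hx => ?_, ?_⟩
  · rw [InnerProductSpace.toDual_symm_apply]
    by_contra! h
    have := hf _ (hW.smul_mem_cone hx (r := r / f x) (div_nonneg_of_nonpos hr.le h.le))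
    rw [map_smul, smul_eq_mul, div_mul_cancel₀ _ h.ne] at this
    exact lt_irrefl _ this
  · rw [InnerProductSpace.toDual_symm_apply]
    exact hfu.trans hr

/-- The bipolar theorem for unit vectors. -/
theorem mem_of_forall_dualSet [CompleteSpace E] (hW : IsUnitBody W) {u : E} (hu : ‖u‖ = 1)
    (h : ∀ m ∈ dualSet W, 0 ≤ ⟪m, u⟫) : u ∈ W := by
  have hc : u ∈ cone W := by
    by_contra hn
    obtain ⟨m, hm, hmu⟩ := hW.exists_dual_neg hn
    have hm0 : m ≠ 0 := by rintro rfl; simp at hmu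
    have hp : 0 < ‖m‖⁻¹ := by positivity
    have := h (‖m‖⁻¹ • m) ⟨norm_inv_smul_self hm0, fun x hx => by
      rw [real_inner_smul_left]; exact mul_nonneg hp.le (hm x hx)⟩
    rw [real_inner_smul_left] at this
    nlinarith
  obtain ⟨x, hx, e⟩ := hc
  rw [hu, one_smul] at e
  exact e ▸ hx

/-- For each `y` in `W`, separating `-y` from the cone gives a dual vector positive at `y`; by
compactness a finite sum of such vectors is positive on all of `W`. -/
theorem exists_forall_inner_pos [CompleteSpace E] (hW : IsUnitBody W) :
    ∃ o : E, ∀ y ∈ W, 0 < ⟪o, y⟫ := by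
  suffices H : ∃ o : E, (∀ x ∈ W, 0 ≤ ⟪o, x⟫) ∧ ∀ y ∈ W, y ∈ W → 0 < ⟪o, y⟫ by
    obtain ⟨o, -, h⟩ := H
    exact ⟨o, fun y hy => h y hy hy⟩
  refine hW.compact.induction_on
    (p := fun s => ∃ o : E, (∀ x ∈ W, 0 ≤ ⟪o, x⟫) ∧ ∀ y ∈ s, y ∈ W → 0 < ⟪o, y⟫)
    ⟨0, by simp⟩ ?_ ?_ ?_
  · rintro s t hst ⟨o, h1, h2⟩
    exact ⟨o, h1, fun y hy => h2 y (hst hy)⟩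
  · rintro s t ⟨o, h1, h2⟩ ⟨o', h1', h2'⟩
    refine ⟨o + o', fun x hx => ?_, fun y hy hyW => ?_⟩
    · rw [inner_add_left]; exact add_nonneg (h1 x hx) (h1' x hx)
    · rw [inner_add_left]
      rcases hy with hy | hy
      · exact add_pos_of_pos_of_nonneg (h2 y hy hyW) (h1' y hyW)
      · exact add_pos_of_nonneg_of_pos (h1 y hyW) (h2' y hy hyW)
  · intro y hy
    have hn : -y ∉ cone W := by
      rintro ⟨x, hx, e⟩
      rw [norm_neg, hW.norm_eq y hy, one_smul] at e
      exact hW.neg_notMem y hy (e ▸ hx)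
    obtain ⟨m, hm, hmy⟩ := hW.exists_dual_neg hn
    rw [inner_neg_right, neg_lt_zero] at hmy
    have hopen : IsOpen {x : E | 0 < ⟪m, x⟫} := isOpen_lt (by fun_prop) (by fun_prop)
    exact ⟨_, mem_nhdsWithin_of_mem_nhds (hopen.mem_nhds hmy), m, hm, fun x hx _ => hx⟩

/-- Some point of `W` lies in the interior of the dual cone. -/
theorem exists_mem_forall_inner_pos [CompleteSpace E] (hW : IsUnitBody W) :
    ∃ o ∈ W, ∀ y ∈ W, 0 < ⟪o, y⟫ := by
  obtain ⟨m, hm⟩ := hW.exists_forall_inner_pos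
  -- The point `z` of `Q` nearest to the origin satisfies `⟪z, q⟫ ≥ ‖z‖ ^ 2 > 0` for `q` in `Q`, and
  -- every ray through a point of `W` meets `Q`.
  set Q : Set E := cone W ∩ {z | 1 ≤ ⟪m, z⟫} with hQ
  have hQc : Convex ℝ Q := hW.convex_cone.inter
    (convex_halfSpace_ge (f := fun z => ⟪m, z⟫) (innerₗ E m).isLinear 1)
  have hQcl : IsClosed Q := hW.isClosed_cone.inter (isClosed_le (by fun_prop) (by fun_prop))
  have hmem : ∀ y ∈ W, (⟪m, y⟫)⁻¹ • y ∈ Q := fun y hy =>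
    ⟨hW.smul_mem_cone hy (inv_nonneg.2 (hm y hy).le), by
      simp only [Set.mem_ofPred_eq, real_inner_smul_right]
      rw [inv_mul_cancel₀ (hm y hy).ne']⟩
  obtain ⟨x₀, hx₀⟩ := hW.nonempty
  obtain ⟨z, hzQ, hz⟩ := exists_norm_eq_iInf_of_complete_convex ⟨_, hmem x₀ hx₀⟩
    hQcl.isComplete hQc 0
  rw [norm_eq_iInf_iff_real_inner_le_zero hQc hzQ] at hz
  have hz0 : z ≠ 0 := by
    rintro rfl
    have := hzQ.2
    simp only [Set.mem_ofPred_eq, inner_zero_right] at this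
    linarith
  have hzp : 0 < ‖z‖ := norm_pos_iff.2 hz0
  obtain ⟨o, ho, e⟩ := hzQ.1
  refine ⟨o, ho, fun y hy => ?_⟩
  have h1 := hz _ (hmem y hy)
  rw [zero_sub, inner_neg_left, inner_sub_right, real_inner_self_eq_norm_sq,
    real_inner_smul_right] at h1
  have h2 : 0 < (⟪m, y⟫)⁻¹ * ⟪z, y⟫ := by nlinarith
  have h3 : 0 < ⟪z, y⟫ := (pos_iff_pos_of_mul_pos h2).1 (inv_pos.2 (hm y hy))
  rw [e, real_inner_smul_left] at h3
  exact (pos_iff_pos_of_mul_pos h3).1 hzp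

/-- The ray from an interior point of the dual cone in a direction outside of this cone meets the
boundary of the cone. -/
theorem exists_add_smul_boundary (hW : IsUnitBody W) {o z : E} (ho : ∀ y ∈ W, 0 < ⟪o, y⟫)
    (hz : ∃ y ∈ W, ⟪z, y⟫ < 0) :
    ∃ t : ℝ, 0 < t ∧ (∀ y ∈ W, 0 ≤ ⟪o + t • z, y⟫) ∧ ∃ y ∈ W, ⟪o + t • z, y⟫ = 0 := by
  -- The ray satisfies the constraint of `y` as long as `t` times this quotient is at most `1`, so
  -- it leaves the cone at the inverse of the maximal quotient.
  have hcont : ContinuousOn (fun y => -⟪z, y⟫ / ⟪o, y⟫) W :=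
    ContinuousOn.div (by fun_prop) (by fun_prop) fun y hy => (ho y hy).ne'
  obtain ⟨y₀, hy₀, hmax⟩ := hW.compact.exists_isMaxOn hW.nonempty hcont
  obtain ⟨y₁, hy₁, hneg⟩ := hz
  set M := -⟪z, y₀⟫ / ⟪o, y₀⟫ with hM
  have hMpos : 0 < M :=
    lt_of_lt_of_le (div_pos (neg_pos.2 hneg) (ho y₁ hy₁)) (hmax hy₁)
  refine ⟨M⁻¹, inv_pos.2 hMpos, fun y hy => ?_, y₀, hy₀, ?_⟩
  · have h1 : -⟪z, y⟫ / ⟪o, y⟫ ≤ M := hmax hy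
    rw [div_le_iff₀ (ho y hy)] at h1
    rw [inner_add_left, real_inner_smul_left]
    have h2 : M⁻¹ * (-⟪z, y⟫) ≤ M⁻¹ * (M * ⟪o, y⟫) := by gcongr
    rw [inv_mul_cancel_left₀ hMpos.ne'] at h2
    linarith
  · have h1 : M * ⟪o, y₀⟫ = -⟪z, y₀⟫ := div_mul_cancel₀ _ (ho y₀ hy₀).ne'
    have h2 : M⁻¹ * (M * ⟪o, y₀⟫) = M⁻¹ * (-⟪z, y₀⟫) := by rw [h1]
    rw [inv_mul_cancel_left₀ hMpos.ne'] at h2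
    rw [inner_add_left, real_inner_smul_left]
    linarith

theorem inv_norm_smul_mem_dualBoundary {z : E} (hz : z ≠ 0) (h : ∀ y ∈ W, 0 ≤ ⟪z, y⟫)
    (h0 : ∃ y ∈ W, ⟪z, y⟫ = 0) : ‖z‖⁻¹ • z ∈ dualBoundary W := by
  obtain ⟨y, hy, e⟩ := h0
  refine ⟨⟨norm_inv_smul_self hz, fun x hx => ?_⟩, y, hy, ?_⟩
  · rw [real_inner_smul_left]; exact mul_nonneg (by positivity) (h x hx)
  · rw [real_inner_smul_left, e, mul_zero]

theorem neg_notMem_dualSet (hW : IsUnitBody W) {k : E} (hk : k ∈ dualSet W) : -k ∉ dualSet W := by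
  intro hn
  obtain ⟨x, hx, h⟩ := hW.exists_inner_ne k (norm_ne_zero_iff.1 (by rw [hk.1]; exact one_ne_zero))
  have h1 := hk.2 x hx
  have h2 := hn.2 x hx
  rw [inner_neg_left] at h2
  exact h (by linarith)

theorem dualSet_add_mem (a : E) (ha : a ∈ dualSet W) (b : E) (hb : b ∈ dualSet W) (s t : ℝ)
    (hs : 0 ≤ s) (ht : 0 ≤ t) (h : ‖s • a + t • b‖ = 1) : s • a + t • b ∈ dualSet W := by
  refine ⟨h, fun x hx => ?_⟩
  rw [inner_add_left, real_inner_smul_left, real_inner_smul_left]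
  exact add_nonneg (mul_nonneg hs (ha.2 x hx)) (mul_nonneg ht (hb.2 x hx))

/-- The farthest point of `W` from a given point `x` yields a boundary point of the dual body. -/
theorem sub_smul_mem_dualBoundary (hW : IsUnitBody W) {x y : E} (hx : x ∈ W) (hy : y ∈ W)
    (hne : x ≠ y) (hmin : ∀ z ∈ W, ⟪x, y⟫ ≤ ⟪x, z⟫) :
    ‖x - ⟪x, y⟫ • y‖⁻¹ • (x - ⟪x, y⟫ • y) ∈ dualBoundary W := by
  have hne' : x ≠ -y := fun h => hW.neg_notMem y hy (h ▸ hx)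
  have hsq := inner_sq_lt_one (hW.norm_eq x hx) (hW.norm_eq y hy) hne hne'
  have hN := norm_sub_smul_sq (hW.norm_eq x hx) (hW.norm_eq y hy)
  refine inv_norm_smul_mem_dualBoundary ?_ (fun z hz => ?_) ⟨y, hy, ?_⟩
  · intro h
    rw [h, norm_zero] at hN
    linarith
  · have := inner_mul_inner_le_of_forall_le hW.norm_eq hW.add_mem (hW.norm_eq x hx) hy hmin hz
    rw [inner_sub_left, real_inner_smul_left]
    linarith
  · rw [inner_sub_left, real_inner_smul_left, real_inner_self_eq_norm_sq, hW.norm_eq y hy]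
    ring

/-- The endpoints of a diameter of `W`. -/
theorem exists_diametral (hW : IsUnitBody W) :
    ∃ x ∈ W, ∃ y ∈ W, ∀ a ∈ W, ∀ b ∈ W, ⟪x, y⟫ ≤ ⟪a, b⟫ := by
  have hc : ContinuousOn (fun p : E × E => ⟪p.1, p.2⟫) (W ×ˢ W) := by fun_prop
  obtain ⟨⟨x, y⟩, ⟨hx, hy⟩, hmin⟩ :=
    (hW.compact.prod hW.compact).exists_isMinOn (hW.nonempty.prod hW.nonempty) hc
  exact ⟨x, hx, y, hy, fun a ha b hb => hmin (Set.mk_mem_prod ha hb)⟩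

end IsUnitBody
end Polarity
end SphericalConvex

namespace SphericalConvex

/-! ### Bodies whose dual boundary has constant diameter `arccos c`. -/

section ConstantDiameter

variable {E : Type*} [NormedAddCommGroup E] [InnerProductSpace ℝ E]

namespace IsUnitBody

variable {W : Set E}

/-- The two ends of a diametral arc give two different supporting normals, so one of them avoids
`k`. The choice `k = 0` merely yields a point of the dual boundary. -/
theorem exists_ne_mem_dualBoundary (hW : IsUnitBody W) (hnt : W.Nontrivial) (k : E) :
    ∃ m ∈ dualBoundary W, m ≠ k := by
  obtain ⟨x, hx, y, hy, hmin⟩ := hW.exists_diametral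
  have hxy : x ≠ y := by
    rintro rfl
    obtain ⟨a, ha, b, hb, hab⟩ := hnt
    have h := hmin a ha b hb
    rw [real_inner_self_eq_norm_sq, hW.norm_eq x hx] at h
    have h' := abs_le.1 (abs_inner_le_one (hW.norm_eq a ha) (hW.norm_eq b hb))
    exact hab (eq_of_inner_eq_one (hW.norm_eq a ha) (hW.norm_eq b hb) (by linarith))
  have hp := hW.sub_smul_mem_dualBoundary hx hy hxy fun z hz => hmin x hx z hz
  have hq := hW.sub_smul_mem_dualBoundary hy hx hxy.symm fun z hz => by
    rw [real_inner_comm]; exact hmin y hy z hz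
  by_cases h : ‖x - ⟪x, y⟫ • y‖⁻¹ • (x - ⟪x, y⟫ • y) = k
  · refine ⟨_, hq, fun h' => ?_⟩
    rw [← h] at h'
    have hsq := inner_sq_lt_one (hW.norm_eq x hx) (hW.norm_eq y hy) hxy
      fun h => hW.neg_notMem y hy (h ▸ hx)
    have h1 := norm_sub_smul_sq (hW.norm_eq x hx) (hW.norm_eq y hy)
    have h2 := norm_sub_smul_sq (hW.norm_eq y hy) (hW.norm_eq x hx)
    rw [real_inner_comm] at h'
    rw [real_inner_comm] at h2
    have h3 : ‖y - ⟪x, y⟫ • x‖ = ‖x - ⟪x, y⟫ • y‖ :=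
      (pow_left_inj₀ (norm_nonneg _) (norm_nonneg _) two_ne_zero).1 (h2.trans h1.symm)
    rw [h3] at h'
    have h4 : ‖x - ⟪x, y⟫ • y‖ ≠ 0 := by
      intro h; rw [h] at h1; norm_num at h1; nlinarith
    have h5 := smul_right_injective E (inv_ne_zero h4) h'
    have h6 : (1 + ⟪x, y⟫) • (x - y) = 0 := by
      have : (1 + ⟪x, y⟫) • (x - y) = (x - ⟪x, y⟫ • y) - (y - ⟪x, y⟫ • x) := by module
      rw [this]; exact sub_eq_zero.2 h5.symm
    rcases smul_eq_zero.1 h6 with h | h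
    · nlinarith
    · exact hxy (sub_eq_zero.1 h)
  · exact ⟨_, hp, h⟩

variable {c : ℝ}

/-- If the boundary of the dual body has diameter `arccos c`, then the boundary points are at
distance less than `arccos c` from the interior points. -/
theorem lt_inner_of_forall_pos (hW : IsUnitBody W)
    (hA : ∀ k ∈ dualBoundary W, ∀ m ∈ dualBoundary W, c ≤ ⟪k, m⟫) {o k : E} (ho1 : ‖o‖ = 1)
    (ho : ∀ y ∈ W, 0 < ⟪o, y⟫) (hk : k ∈ dualBoundary W) : c < ⟪k, o⟫ := by
  obtain ⟨x₀, hx₀, hkx₀⟩ := hk.2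
  obtain ⟨x₁, hx₁, hkx₁⟩ := hW.exists_inner_ne k
    (norm_ne_zero_iff.1 (by rw [hk.1.1]; exact one_ne_zero))
  -- The arc from `k` through `o` is prolonged to a boundary point `n`. Then `o = l n + t k` with
  -- `l, t > 0`, so `o` is strictly closer to `k` than `n` is.
  obtain ⟨t, ht, hpos, hzero⟩ := hW.exists_add_smul_boundary ho (z := -k) ⟨x₁, hx₁, by
    rw [inner_neg_left, neg_lt_zero]; exact lt_of_le_of_ne (hk.1.2 x₁ hx₁) hkx₁.symm⟩
  set z := o + t • -k with hz
  have hzx₀ : 0 < ⟪z, x₀⟫ := by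
    rw [hz, inner_add_left, real_inner_smul_left, inner_neg_left, hkx₀]
    simpa using ho x₀ hx₀
  have hz0 : z ≠ 0 := by rintro h; rw [h] at hzx₀; simp at hzx₀
  have hn := inv_norm_smul_mem_dualBoundary hz0 hpos hzero
  set l := ‖z‖ with hl
  have hlp : 0 < l := norm_pos_iff.2 hz0
  set n := l⁻¹ • z with hndef
  have hzn : z = l • n := by rw [hndef, smul_smul, mul_inv_cancel₀ hlp.ne', one_smul]
  have hno : o = l • n + t • k := by rw [← hzn, hz]; module
  clear_value n
  have hnk : k ≠ n := by
    intro h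
    rw [hzn, ← h, real_inner_smul_left, hkx₀, mul_zero] at hzx₀
    exact lt_irrefl _ hzx₀
  have hnk' : k ≠ -n := by
    intro h
    exact hW.neg_notMem_dualSet hn.1 (h ▸ hk.1)
  have hsq := inner_sq_lt_one hk.1.1 hn.1.1 hnk hnk'
  have hca := hA k hk n hn
  have hnorm := norm_add_smul_sq hn.1.1 hk.1.1 l t
  rw [← hno, ho1, real_inner_comm] at hnorm
  have hko : ⟪k, o⟫ = l * ⟪k, n⟫ + t := by
    rw [hno, inner_add_right, real_inner_smul_right, real_inner_smul_right,
      real_inner_self_eq_norm_sq, hk.1.1]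
    ring
  refine lt_of_le_of_lt hca ?_
  rw [hko]
  generalize ⟪k, n⟫ = a at *
  have key : (l * a + t) ^ 2 - a ^ 2 = t * (1 - a ^ 2) * (t + 2 * l * a) := by
    linear_combination (-a ^ 2) * hnorm
  have hta : 0 < t * (1 - a ^ 2) := mul_pos ht (by linarith)
  by_contra! hcon
  rcases lt_or_ge (l * a + t) 0 with h | h
  · have h1 : t + 2 * l * a < 0 := by nlinarith
    have h2 := mul_neg_of_pos_of_neg hta h1
    rcases le_total 0 a with h3 | h3
    · nlinarith [mul_nonneg hlp.le h3]
    · nlinarith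
  · have ha : 0 ≤ a := h.trans hcon
    have h1 : 0 < t + 2 * l * a := by positivity
    have h2 := mul_pos hta h1
    nlinarith

theorem forall_pos_or_mem_dualBoundary {m : E} (hm : m ∈ dualSet W) :
    (∀ y ∈ W, 0 < ⟪m, y⟫) ∨ m ∈ dualBoundary W := by
  by_cases h : ∃ y ∈ W, ⟪m, y⟫ = 0
  · exact Or.inr ⟨hm, h⟩
  · push Not at h
    exact Or.inl fun y hy => lt_of_le_of_ne (hm.2 y hy) (h y hy).symm

theorem le_inner_of_mem_dualSet (hW : IsUnitBody W)
    (hA : ∀ k ∈ dualBoundary W, ∀ m ∈ dualBoundary W, c ≤ ⟪k, m⟫) {k m : E}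
    (hk : k ∈ dualBoundary W) (hm : m ∈ dualSet W) : c ≤ ⟪k, m⟫ := by
  rcases forall_pos_or_mem_dualBoundary hm with h | h
  · exact (hW.lt_inner_of_forall_pos hA hm.1 h hk).le
  · exact hA k hk m h

/-- The value `c = 1` would leave only one boundary point, and `c = -1` would put antipodes into the
dual body. -/
theorem sq_lt_one_of_constantDiameter (hW : IsUnitBody W) (hnt : W.Nontrivial)
    (hA : ∀ k ∈ dualBoundary W, ∀ m ∈ dualBoundary W, c ≤ ⟪k, m⟫)
    (hB : ∀ k ∈ dualBoundary W, ∃ m ∈ dualBoundary W, ⟪k, m⟫ = c) : c ^ 2 < 1 := by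
  obtain ⟨k, hk, -⟩ := hW.exists_ne_mem_dualBoundary hnt 0
  obtain ⟨m, hm, e⟩ := hB k hk
  obtain ⟨n, hn, hnk⟩ := hW.exists_ne_mem_dualBoundary hnt k
  rw [← e]
  refine inner_sq_lt_one hk.1.1 hm.1.1 ?_ fun h => hW.neg_notMem_dualSet hm.1 (h ▸ hk.1)
  rintro rfl
  rw [real_inner_self_eq_norm_sq, hk.1.1] at e
  have h1 := hA k hk n hn
  have h2 := abs_le.1 (abs_inner_le_one hk.1.1 hn.1.1)
  exact hnk (eq_of_inner_eq_one hk.1.1 hn.1.1 (by linarith)).symm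

/-- Some points of `W` are at distance `π - arccos c`. -/
theorem exists_inner_eq_neg [CompleteSpace E] (hW : IsUnitBody W) (hnt : W.Nontrivial)
    (hA : ∀ k ∈ dualBoundary W, ∀ m ∈ dualBoundary W, c ≤ ⟪k, m⟫)
    (hB : ∀ k ∈ dualBoundary W, ∃ m ∈ dualBoundary W, ⟪k, m⟫ = c) :
    ∃ x ∈ W, ∃ y ∈ W, ⟪x, y⟫ = -c := by
  have hc := hW.sq_lt_one_of_constantDiameter hnt hA hB
  have hmem : ∀ k ∈ dualBoundary W, ∀ m ∈ dualBoundary W, ⟪k, m⟫ = c →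
      ‖k - c • m‖ ^ 2 = 1 - c ^ 2 ∧ ‖k - c • m‖⁻¹ • (k - c • m) ∈ W := by
    intro k hk m hm e
    have hN := norm_sub_smul_sq hk.1.1 hm.1.1
    rw [e] at hN
    have h0 : k - c • m ≠ 0 := by
      intro h; rw [h, norm_zero] at hN; linarith
    refine ⟨hN, hW.mem_of_forall_dualSet (norm_inv_smul_self h0) fun z hz => ?_⟩
    -- In the dual body `m` is farthest from `k`, so that body lies in the hemisphere around the
    -- normalized `k - c • m`.
    have := inner_mul_inner_le_of_forall_le (fun x (hx : x ∈ dualSet W) => hx.1) dualSet_add_mem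
      hk.1.1 hm.1 (fun x hx => by rw [e]; exact hW.le_inner_of_mem_dualSet hA hk hx) hz
    rw [e] at this
    rw [real_inner_smul_right, inner_sub_right, real_inner_smul_right, real_inner_comm,
      real_inner_comm m z]
    exact mul_nonneg (by positivity) (by linarith)
  obtain ⟨k, hk, -⟩ := hW.exists_ne_mem_dualBoundary hnt 0
  obtain ⟨m, hm, e⟩ := hB k hk
  obtain ⟨h1, hu⟩ := hmem k hk m hm e
  obtain ⟨h2, hv⟩ := hmem m hm k hk (by rw [real_inner_comm, e])
  refine ⟨_, hu, _, hv, ?_⟩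
  have h3 : ‖m - c • k‖ = ‖k - c • m‖ :=
    (pow_left_inj₀ (norm_nonneg _) (norm_nonneg _) two_ne_zero).1 (h2.trans h1.symm)
  have h4 : ‖k - c • m‖ ≠ 0 := by intro h; rw [h] at h1; norm_num at h1; linarith
  rw [h3, real_inner_smul_left, real_inner_smul_right, inner_sub_left, inner_sub_right,
    inner_sub_right, real_inner_smul_left, real_inner_smul_left, real_inner_smul_right,
    real_inner_smul_right, real_inner_self_eq_norm_sq, real_inner_self_eq_norm_sq, hk.1.1, hm.1.1,
    real_inner_comm k m, e]
  field_simp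
  rw [h1]; ring

/-! ### Upper bound for the diameter, width below `π/2`. -/

/-- Cauchy–Schwarz for the components of `p'` and `z` orthogonal to `p`. Geometrically, a point of a
non-obtuse lune is no farther from the great sphere of one side than the thickness of the lune. -/
theorem inner_sq_le_of_constantDiameter (hc : c ≤ 0) {p p' z : E} (hp : ‖p‖ = 1) (hp' : ‖p'‖ = 1)
    (hz : ‖z‖ = 1) (e : ⟪p, p'⟫ = c) (h : 0 ≤ ⟪p, z⟫) (h' : 0 ≤ ⟪p', z⟫) :
    ⟪p, z⟫ ^ 2 ≤ 1 - c ^ 2 := by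
  have h1 : ⟪p' - c • p, z - ⟪p, z⟫ • p⟫ = ⟪p', z⟫ - c * ⟪p, z⟫ := by
    rw [inner_sub_left, inner_sub_right, inner_sub_right, real_inner_smul_left,
      real_inner_smul_left, real_inner_smul_right, real_inner_smul_right,
      real_inner_self_eq_norm_sq, hp, real_inner_comm p p', e]
    ring
  have h2 := abs_real_inner_le_norm (p' - c • p) (z - ⟪p, z⟫ • p)
  have h3 := norm_sub_smul_sq hp' hp
  have h4 := norm_sub_smul_sq hz hp
  rw [real_inner_comm] at h3 h4
  rw [e] at h3
  rw [h1] at h2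
  have h5 : 0 ≤ -c * ⟪p, z⟫ := mul_nonneg (by linarith) h
  have h6 : -c * ⟪p, z⟫ ≤ ‖p' - c • p‖ * ‖z - ⟪p, z⟫ • p‖ := by
    have := le_abs_self (⟪p', z⟫ - c * ⟪p, z⟫); linarith
  have h7 := pow_le_pow_left₀ h5 h6 2
  rw [mul_pow, mul_pow, h3, h4] at h7
  nlinarith

/-- The upper bound for the diameter of bodies of width less than `π/2`. -/
theorem neg_le_inner_of_neg [CompleteSpace E] (hW : IsUnitBody W) (hc : c < 0)
    (hc1 : c ^ 2 < 1) (hB : ∀ k ∈ dualBoundary W, ∃ m ∈ dualBoundary W, ⟪k, m⟫ = c)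
    {x y : E} (hx : x ∈ W) (hy : y ∈ W) : -c ≤ ⟪x, y⟫ := by
  have hstrip : ∀ p ∈ dualBoundary W, ∀ z ∈ W, ⟪p, z⟫ ^ 2 ≤ 1 - c ^ 2 := by
    intro p hp z hz
    obtain ⟨p', hp', e⟩ := hB p hp
    exact inner_sq_le_of_constantDiameter hc.le hp.1.1 hp'.1.1 (hW.norm_eq z hz) e (hp.1.2 z hz)
      (hp'.1.2 z hz)
  -- Otherwise the ray from `o` in direction `x` leaves the dual cone at a point that is, after
  -- normalization, both in `W` and in the dual boundary; `hstrip` with `p` and `z` equal to this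
  -- point reads `1 ≤ 1 - c ^ 2`.
  have hnn : ∀ x ∈ W, ∀ y ∈ W, 0 ≤ ⟪x, y⟫ := by
    intro x hx y hy
    by_contra! hneg
    obtain ⟨o, hoW, ho⟩ := hW.exists_mem_forall_inner_pos
    obtain ⟨t, ht, hpos, hzero⟩ := hW.exists_add_smul_boundary ho ⟨y, hy, hneg⟩
    have hne : o + t • x ≠ 0 := by
      intro h
      have h1 := ho o hoW
      have h2 := ho x hx
      have h3 : ⟪o, o + t • x⟫ = 0 := by rw [h, inner_zero_right]
      rw [inner_add_right, real_inner_smul_right] at h3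
      nlinarith [mul_pos ht h2]
    have hn := inv_norm_smul_mem_dualBoundary hne hpos hzero
    have hnW := hW.inv_norm_smul_add_mem hoW hx zero_le_one ht.le (by rwa [one_smul])
    rw [one_smul] at hnW
    have := hstrip _ hn _ hnW
    rw [real_inner_self_eq_norm_sq, hn.1.1] at this
    nlinarith
  obtain ⟨a, ha, b, hb, hmin⟩ := hW.exists_diametral
  refine le_trans ?_ (hmin x hx y hy)
  by_cases hab : a = b
  · rw [hab, real_inner_self_eq_norm_sq, hW.norm_eq b hb]
    nlinarith
  have hp := hW.sub_smul_mem_dualBoundary ha hb hab fun z hz => hmin a ha z hz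
  have h1 := norm_sub_smul_sq (hW.norm_eq a ha) (hW.norm_eq b hb)
  have h2 := hstrip _ hp a ha
  have h3 : ⟪a - ⟪a, b⟫ • b, a⟫ = ‖a - ⟪a, b⟫ • b‖ ^ 2 := by
    rw [h1, inner_sub_left, real_inner_smul_left, real_inner_self_eq_norm_sq, hW.norm_eq a ha,
      real_inner_comm]
    ring
  have h4 : ‖a - ⟪a, b⟫ • b‖ ≠ 0 := by
    intro h; rw [h] at hp; simpa using hp.1.1
  rw [real_inner_smul_left, h3, pow_two ‖_‖, inv_mul_cancel_left₀ h4, h1] at h2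
  have := hnn a ha b hb
  nlinarith

/-! ### Upper bound for the diameter, width at least `π/2`. -/

/-- For `0 ≤ c`, the dual body is the intersection of the balls of radius `arccos c` centred at its
boundary points. -/
theorem mem_dualSet_of_forall_le [CompleteSpace E] (hW : IsUnitBody W) (hc : 0 ≤ c)
    (hA : ∀ k ∈ dualBoundary W, ∀ m ∈ dualBoundary W, c ≤ ⟪k, m⟫)
    (hB : ∀ k ∈ dualBoundary W, ∃ m ∈ dualBoundary W, ⟪k, m⟫ = c)
    (hne : (dualBoundary W).Nonempty) {z : E} (hz : ‖z‖ = 1) (h : ∀ m ∈ dualBoundary W, c ≤ ⟪m, z⟫) : z ∈ dualSet W := by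
  refine ⟨hz, ?_⟩
  by_contra! hneg
  -- The arc from `o` to an outside point `z` crosses the dual boundary, and the crossing point has
  -- a partner `m` at inner product `c`. But `⟪m, o⟫ > c`, `⟪m, z⟫ ≥ c` and `‖o + t • z‖ ≤ 1 + t`
  -- make that inner product larger than `c`.
  obtain ⟨o, hoW, ho⟩ := hW.exists_mem_forall_inner_pos
  have ho1 := hW.norm_eq o hoW
  obtain ⟨t, ht, hpos, hzero⟩ := hW.exists_add_smul_boundary ho hneg
  by_cases hoz : o + t • z = 0
  · obtain ⟨k, hk⟩ := hne
    have h1 := hW.lt_inner_of_forall_pos hA ho1 ho hk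
    have h2 := h k hk
    have h3 : ⟪k, o + t • z⟫ = 0 := by rw [hoz, inner_zero_right]
    rw [inner_add_right, real_inner_smul_right] at h3
    nlinarith
  · have hn := inv_norm_smul_mem_dualBoundary hoz hpos hzero
    obtain ⟨m, hm, e⟩ := hB _ hn
    have h1 := hW.lt_inner_of_forall_pos hA ho1 ho hm
    have h2 := h m hm
    have h3 : ‖o + t • z‖ ≤ 1 + t := by
      refine (norm_add_le _ _).trans ?_
      rw [ho1, norm_smul, hz, Real.norm_of_nonneg ht.le, mul_one]
    rw [real_inner_smul_left, inv_mul_eq_iff_eq_mul₀ (norm_ne_zero_iff.2 hoz), real_inner_comm,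
      inner_add_right, real_inner_smul_right] at e
    nlinarith

/-- Supplies the step size for the perturbation of `p` in `le_inner_smul_add_smul`. -/
theorem exists_pos_mul_le (α : ℝ) {V b : ℝ} (hV : 0 ≤ V) (hb : 0 < b) :
    ∃ σ : ℝ, 0 < σ ∧ 0 ≤ 1 + σ * α ∧ σ * V ≤ b := by
  have hA1 : 0 < 1 + |α| := by positivity
  have hV1 : 0 < 1 + V := by positivity
  have h0 : 0 < min (1 / (1 + |α|)) (b / (1 + V)) := lt_min (by positivity) (by positivity)
  refine ⟨_, h0, ?_, ?_⟩
  · have h1 := min_le_left (1 / (1 + |α|)) (b / (1 + V))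
    rw [le_div_iff₀ hA1] at h1
    nlinarith [neg_abs_le α]
  · have h1 := min_le_right (1 / (1 + |α|)) (b / (1 + V))
    rw [le_div_iff₀ hV1] at h1
    nlinarith

/-- If the point `b` of `W` is orthogonal to the boundary point `p` of the dual body, then the ball of
radius `arccos c` touching at `p` the great sphere orthogonal to `b` contains the boundary of the
dual body. -/
theorem le_inner_smul_add_smul [CompleteSpace E] (hW : IsUnitBody W) (hc : 0 ≤ c)
    (hA : ∀ k ∈ dualBoundary W, ∀ m ∈ dualBoundary W, c ≤ ⟪k, m⟫)
    (hB : ∀ k ∈ dualBoundary W, ∃ m ∈ dualBoundary W, ⟪k, m⟫ = c)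
    {s : ℝ} (hs : 0 < s) (hcs : c ^ 2 + s ^ 2 = 1) {p b k : E} (hp : p ∈ dualBoundary W)
    (hb : b ∈ W) (hpb : ⟪p, b⟫ = 0) (hk : k ∈ dualBoundary W) : c ≤ ⟪k, c • p + s • b⟫ := by
  by_contra! hlt
  have hb1 := hW.norm_eq b hb
  set q := c • p + s • b with hq
  have hq1 : ‖q‖ = 1 := by
    have := norm_add_smul_sq hp.1.1 hb1 c s
    rw [← hq, hpb, mul_zero, add_zero, hcs] at this
    exact (pow_eq_one_iff_of_nonneg (norm_nonneg _) two_ne_zero).1 this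
  have hpq : ⟪p, q⟫ = c := by
    rw [hq, inner_add_right, real_inner_smul_right, real_inner_smul_right,
      real_inner_self_eq_norm_sq, hp.1.1, hpb]
    ring
  have hqb : ⟪q, b⟫ = s := by
    rw [hq, inner_add_left, real_inner_smul_left, real_inner_smul_left,
      real_inner_self_eq_norm_sq, hb1, hpb]
    ring
  have hkq : ⟪k, q⟫ = c * ⟪p, k⟫ + s * ⟪k, b⟫ := by
    rw [hq, inner_add_right, real_inner_smul_right, real_inner_smul_right, real_inner_comm p k]
  have hkb := hk.1.2 b hb
  set r := ⟪p, k⟫ with hr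
  have hr1 : r ≤ 1 := (abs_le.1 (abs_inner_le_one hp.1.1 hk.1.1)).2
  have hc1 : c < 1 := by nlinarith
  -- Half of the assumed deficit serves as slack.
  obtain ⟨η, hη⟩ : ∃ η, 2 * η = c - ⟪k, q⟫ := ⟨(c - ⟪k, q⟫) / 2, by ring⟩
  have hη0 : 0 < η := by linarith
  have hηr : 2 * η ≤ 1 - r := by nlinarith [mul_nonneg hs.le hkb]
  -- The point `p` is moved slightly along `v`. As `α c + β c - (α + β) c = 0`, the moved point
  -- keeps inner product at least `c` with every boundary point; these `α`, `β` also make `⟪p, v⟫`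
  -- and `⟪v, b⟫` negative. So the norm does not exceed `1`, normalizing is harmless for `0 ≤ c`,
  -- and the result is in the dual body although its inner product with `b` is negative.
  set α := c ^ 2 - r - η with hα
  set β := 1 - c ^ 2 with hβ
  have hβ0 : 0 < β := by nlinarith
  set v := α • p + β • k - ((α + β) * c) • q with hv
  have hpv : ⟪p, v⟫ = -(η * β) := by
    rw [hv, inner_sub_right, inner_add_right, real_inner_smul_right, real_inner_smul_right,
      real_inner_smul_right, real_inner_self_eq_norm_sq, hp.1.1, hpq, ← hr, hα, hβ]
    ring
  have hvb : ⟪v, b⟫ < 0 := by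
    have h1 : ⟪v, b⟫ = s * (s * ⟪k, b⟫ - (1 - r) * c + η * c) := by
      rw [hv, inner_sub_left, inner_add_left, real_inner_smul_left, real_inner_smul_left,
        real_inner_smul_left, hpb, hqb]
      linear_combination (⟪k, b⟫) * (hβ - hcs) - (s * c) * (hα + hβ)
    rw [h1]
    exact mul_neg_of_pos_of_neg hs (by nlinarith)
  obtain ⟨σ, hσ0, hσ1, hσ2⟩ := exists_pos_mul_le α (sq_nonneg ‖v‖) (b := 2 * (η * β))
    (by positivity)
  set z := p + σ • v with hz
  have hzb : ⟪z, b⟫ < 0 := by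
    rw [hz, inner_add_left, real_inner_smul_left, hpb, zero_add]
    exact mul_neg_of_pos_of_neg hσ0 hvb
  have hz0 : z ≠ 0 := by rintro h; rw [h] at hzb; simp at hzb
  have hzp : 0 < ‖z‖ := norm_pos_iff.2 hz0
  have hz1 : ‖z‖ ≤ 1 := by
    have h1 : ‖z‖ ^ 2 = 1 + 2 * (σ * ⟪p, v⟫) + σ ^ 2 * ‖v‖ ^ 2 := by
      rw [hz, norm_add_sq_real, real_inner_smul_right, norm_smul, hp.1.1, Real.norm_eq_abs,
        mul_pow, sq_abs]
      ring
    rw [hpv] at h1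
    have h2 := mul_le_mul_of_nonneg_left hσ2 hσ0.le
    refine (sq_le_one_iff₀ hzp.le).1 ?_
    rw [h1]
    linarith
  have hzm : ∀ m ∈ dualBoundary W, c ≤ ⟪m, ‖z‖⁻¹ • z⟫ := by
    intro m hm
    have h1 : ⟪m, z⟫ = (1 + σ * α) * ⟪m, p⟫ + σ * β * ⟪m, k⟫ - σ * ((α + β) * c) * ⟪m, q⟫ := by
      rw [hz, hv, inner_add_right, real_inner_smul_right, inner_sub_right, inner_add_right,
        real_inner_smul_right, real_inner_smul_right, real_inner_smul_right]
      ring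
    have h2 : (1 + σ * α) * c ≤ (1 + σ * α) * ⟪m, p⟫ := mul_le_mul_of_nonneg_left (hA m hm p hp) hσ1
    have h3 : σ * β * c ≤ σ * β * ⟪m, k⟫ := mul_le_mul_of_nonneg_left (hA m hm k hk) (by positivity)
    have hαβ : 0 ≤ α + β := by rw [hα, hβ]; linarith
    have h4 : σ * ((α + β) * c) * ⟪m, q⟫ ≤ σ * ((α + β) * c) * 1 :=
      mul_le_mul_of_nonneg_left (abs_le.1 (abs_inner_le_one hm.1.1 hq1)).2 (by positivity)
    have h5 : c ≤ ⟪m, z⟫ := by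
      rw [h1]
      calc c = (1 + σ * α) * c + σ * β * c - σ * ((α + β) * c) * 1 := by ring
        _ ≤ _ := sub_le_sub (add_le_add h2 h3) h4
    rw [real_inner_smul_right, le_inv_mul_iff₀ hzp]
    exact (mul_le_of_le_one_left hc hz1).trans h5
  have hzD := hW.mem_dualSet_of_forall_le hc hA hB ⟨p, hp⟩ (norm_inv_smul_self hz0) hzm
  have h6 := hzD.2 b hb
  rw [real_inner_smul_left] at h6
  have : 0 < ‖z‖⁻¹ := inv_pos.2 hzp
  nlinarith

/-- The upper bound for the diameter of bodies of width at least `π/2`. -/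
theorem neg_le_inner_of_nonneg [CompleteSpace E] (hW : IsUnitBody W) (hc : 0 ≤ c)
    (hc1 : c ^ 2 < 1) (hA : ∀ k ∈ dualBoundary W, ∀ m ∈ dualBoundary W, c ≤ ⟪k, m⟫)
    (hB : ∀ k ∈ dualBoundary W, ∃ m ∈ dualBoundary W, ⟪k, m⟫ = c)
    {x y : E} (hx : x ∈ W) (hy : y ∈ W) : -c ≤ ⟪x, y⟫ := by
  obtain ⟨a, ha, b, hb, hmin⟩ := hW.exists_diametral
  refine le_trans ?_ (hmin x hx y hy)
  by_contra! hlt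
  have hab : a ≠ b := by
    rintro rfl
    rw [real_inner_self_eq_norm_sq, hW.norm_eq a ha] at hlt
    linarith
  have hp := hW.sub_smul_mem_dualBoundary ha hb hab fun z hz => hmin a ha z hz
  have h1 := norm_sub_smul_sq (hW.norm_eq a ha) (hW.norm_eq b hb)
  set N := ‖a - ⟪a, b⟫ • b‖ with hN
  have h3 : ⟪a - ⟪a, b⟫ • b, a⟫ = N ^ 2 := by
    rw [h1, inner_sub_left, real_inner_smul_left, real_inner_self_eq_norm_sq, hW.norm_eq a ha,
      real_inner_comm]
    ring
  have h4 : N ≠ 0 := by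
    intro h
    have := norm_eq_zero.1 (hN.symm.trans h)
    rw [this] at hp; simpa using hp.1.1
  set p := N⁻¹ • (a - ⟪a, b⟫ • b) with hpdef
  have hpa : ⟪p, a⟫ = N := by
    rw [hpdef, real_inner_smul_left, h3, pow_two, inv_mul_cancel_left₀ h4]
  have hpb : ⟪p, b⟫ = 0 := by
    rw [hpdef, real_inner_smul_left, inner_sub_left, real_inner_smul_left,
      real_inner_self_eq_norm_sq, hW.norm_eq b hb]
    ring
  have hN0 : 0 ≤ N := norm_nonneg _
  clear_value N p
  set s := √(1 - c ^ 2) with hs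
  have hs0 : 0 < s := Real.sqrt_pos.2 (by linarith)
  have hcs : c ^ 2 + s ^ 2 = 1 := by rw [hs, Real.sq_sqrt (by linarith)]; ring
  have hq1 : ‖c • p + s • b‖ = 1 := by
    have := norm_add_smul_sq hp.1.1 (hW.norm_eq b hb) c s
    rw [hpb, mul_zero, add_zero, hcs] at this
    exact (pow_eq_one_iff_of_nonneg (norm_nonneg _) two_ne_zero).1 this
  -- The center of the ball touching at `p` is itself in the dual body, hence nonnegative on `a`.
  have hq := hW.mem_dualSet_of_forall_le hc hA hB ⟨p, hp⟩ hq1 fun k hk =>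
    hW.le_inner_smul_add_smul hc hA hB hs0 hcs hp hb hpb hk
  have h5 := hq.2 a ha
  rw [inner_add_left, real_inner_smul_left, real_inner_smul_left, hpa, real_inner_comm] at h5
  have h6 : s * -⟪a, b⟫ ≤ c * N := by linarith
  have h7 := pow_le_pow_left₀ (mul_nonneg hs0.le (by linarith)) h6 2
  nlinarith

/-- If the dual of `W` has boundary points with all farthest points at distance `arccos c`, then
the diameter of `W` is `π - arccos c`. -/
theorem neg_le_inner [CompleteSpace E] (hW : IsUnitBody W) (hnt : W.Nontrivial)
    (hA : ∀ k ∈ dualBoundary W, ∀ m ∈ dualBoundary W, c ≤ ⟪k, m⟫)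
    (hB : ∀ k ∈ dualBoundary W, ∃ m ∈ dualBoundary W, ⟪k, m⟫ = c)
    {x y : E} (hx : x ∈ W) (hy : y ∈ W) : -c ≤ ⟪x, y⟫ := by
  have hc1 := hW.sq_lt_one_of_constantDiameter hnt hA hB
  rcases lt_or_ge c 0 with hc | hc
  · exact hW.neg_le_inner_of_neg hc hc1 hB hx hy
  · exact hW.neg_le_inner_of_nonneg hc hc1 hA hB hx hy

/-- Compactness turns the infimum in the definition of width into an attained value, as `hB`
requires. -/
theorem isCompact_dualBoundary [FiniteDimensional ℝ E] (hW : IsUnitBody W) :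
    IsCompact (dualBoundary W) := by
  have : ProperSpace E := FiniteDimensional.proper ℝ E
  have : CompactSpace W := isCompact_iff_compactSpace.1 hW.compact
  have hD : IsClosed (dualSet W) := by
    have : dualSet W = {k | ‖k‖ = 1} ∩ ⋂ x ∈ W, {k | 0 ≤ ⟪k, x⟫} := by
      ext; simp [dualSet]
    rw [this]
    exact (isClosed_eq (by fun_prop) (by fun_prop)).inter
      (isClosed_biInter fun x _ => isClosed_le (by fun_prop) (by fun_prop))
  have hZ : IsClosed {k : E | ∃ x ∈ W, ⟪k, x⟫ = 0} := by
    have hcl : IsClosed {p : E × W | ⟪p.1, (p.2 : E)⟫ = 0} :=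
      isClosed_eq (by fun_prop) (by fun_prop)
    convert isClosedMap_fst_of_compactSpace _ hcl using 1
    ext z
    simp
  refine Metric.isCompact_of_isClosed_isBounded (hD.inter hZ) ?_
  refine (Metric.isBounded_closedBall (x := (0 : E)) (r := 1)).subset fun k hk => ?_
  simpa using hk.1.1.le

end IsUnitBody
end ConstantDiameter
end SphericalConvex

namespace SphericalConvex

/-! ### Translation from the sphere to unit vectors. -/

section Sphere

open Topology Filter

variable {d : ℕ}

theorem norm_coe (x : Sph d) : ‖(x : EuclideanSpace ℝ (Fin (d + 1)))‖ = 1 :=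
  norm_eq_of_mem_sphere x

theorem sdist_eq_arccos (a b : Sph d) :
    sdist a b = Real.arccos ⟪(a : EuclideanSpace ℝ (Fin (d + 1))), b⟫ := by
  rw [sdist, InnerProductGeometry.angle, norm_coe, norm_coe, mul_one, div_one]

theorem mem_hemisphere_iff {x m : Sph d} :
    x ∈ hemisphere m ↔ 0 ≤ ⟪(m : EuclideanSpace ℝ (Fin (d + 1))), x⟫ := by
  rw [hemisphere, Set.mem_ofPred_eq, sdist_eq_arccos, Real.arccos_le_pi_div_two, real_inner_comm]

/-- A neighbourhood of a point of the sphere contains points in each direction. -/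
theorem exists_mem_of_mem_nhds {x : Sph d} {S : Set (Sph d)} (hS : S ∈ 𝓝 x)
    (v : EuclideanSpace ℝ (Fin (d + 1))) :
    ∃ t : ℝ, 0 < t ∧ ∃ z ∈ S, ∃ r : ℝ, 0 < r ∧
      (z : EuclideanSpace ℝ (Fin (d + 1))) = r • ((x : EuclideanSpace ℝ (Fin (d + 1))) + t • v) := by
  rw [nhds_subtype_eq_comap] at hS
  obtain ⟨U, hU, hUS⟩ := hS
  set f : ℝ → EuclideanSpace ℝ (Fin (d + 1)) := fun t => (x : EuclideanSpace ℝ (Fin (d + 1))) + t • v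
    with hf
  have hf0 : f 0 = x := by simp [hf]
  have hfc : Continuous f := by fun_prop
  have hne : ∀ᶠ t in 𝓝 (0 : ℝ), f t ≠ 0 := by
    refine hfc.continuousAt.eventually_ne ?_
    rw [hf0]
    exact norm_ne_zero_iff.1 (by rw [norm_coe]; exact one_ne_zero)
  have hg : ContinuousAt (fun t => ‖f t‖⁻¹ • f t) 0 := by
    refine ContinuousAt.smul (ContinuousAt.inv₀ hfc.norm.continuousAt ?_) hfc.continuousAt
    rw [hf0, norm_coe]; exact one_ne_zero
  have hgU : ∀ᶠ t in 𝓝 (0 : ℝ), ‖f t‖⁻¹ • f t ∈ U := by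
    refine hg.eventually_mem ?_
    rw [hf0, norm_coe, inv_one, one_smul]
    exact hU
  obtain ⟨t, ⟨h1, h2⟩, ht⟩ :=
    (((hne.and hgU).filter_mono nhdsWithin_le_nhds).and
      (self_mem_nhdsWithin (a := (0 : ℝ)) (s := Set.Ioi 0))).exists
  refine ⟨t, ht, ⟨‖f t‖⁻¹ • f t, ?_⟩, hUS h2, ‖f t‖⁻¹, by positivity, rfl⟩
  rw [mem_sphere_zero_iff_norm]
  exact norm_inv_smul_self h1

theorem isClosed_hemisphere (m : Sph d) : IsClosed (hemisphere m) := by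
  have : hemisphere m = {x : Sph d | 0 ≤ ⟪(m : EuclideanSpace ℝ (Fin (d + 1))), x⟫} := by
    ext x; exact mem_hemisphere_iff
  rw [this]
  exact isClosed_le (by fun_prop) (by fun_prop)

theorem notMem_interior_of_inner_eq_zero {C : Set (Sph d)} {k x : Sph d} (hC : C ⊆ hemisphere k)
    (h : ⟪(k : EuclideanSpace ℝ (Fin (d + 1))), x⟫ = 0) : x ∉ interior C := by
  intro hx
  obtain ⟨t, ht, z, hz, r, hr, e⟩ := exists_mem_of_mem_nhds (mem_interior_iff_mem_nhds.1 hx)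
    (-(k : EuclideanSpace ℝ (Fin (d + 1))))
  have h1 := mem_hemisphere_iff.1 (hC hz)
  rw [e, real_inner_smul_right, inner_add_right, real_inner_smul_right, inner_neg_right,
    real_inner_self_eq_norm_sq, norm_coe, h] at h1
  nlinarith [mul_pos hr ht]

theorem mem_frontier_hemisphere_iff {x m : Sph d} :
    x ∈ frontier (hemisphere m) ↔ ⟪(m : EuclideanSpace ℝ (Fin (d + 1))), x⟫ = 0 := by
  rw [(isClosed_hemisphere m).frontier_eq]
  constructor
  · rintro ⟨h1, h2⟩
    rw [mem_hemisphere_iff] at h1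
    by_contra h
    refine h2 (mem_interior.2 ⟨{y : Sph d | 0 < ⟪(m : EuclideanSpace ℝ (Fin (d + 1))), y⟫},
      fun y (hy : 0 < _) => mem_hemisphere_iff.2 hy.le, isOpen_lt (by fun_prop) (by fun_prop),
      lt_of_le_of_ne h1 (Ne.symm h)⟩)
  · intro h
    exact ⟨mem_hemisphere_iff.2 h.ge, notMem_interior_of_inner_eq_zero subset_rfl h⟩

theorem supports_iff {W : Set (Sph d)} (hW : IsClosed W) {k : Sph d} :
    Supports k W ↔ (k : EuclideanSpace ℝ (Fin (d + 1))) ∈ dualBoundary (Subtype.val '' W) := by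
  constructor
  · rintro ⟨h, x, hxW, hxk⟩
    refine ⟨⟨norm_coe k, ?_⟩, x, ⟨x, hW.frontier_subset hxW, rfl⟩,
      mem_frontier_hemisphere_iff.1 hxk⟩
    rintro _ ⟨y, hy, rfl⟩
    exact mem_hemisphere_iff.1 (h hy)
  · rintro ⟨⟨-, h⟩, _, ⟨x, hx, rfl⟩, e⟩
    have hsub : W ⊆ hemisphere k := fun y hy => mem_hemisphere_iff.2 (h y ⟨y, hy, rfl⟩)
    refine ⟨hsub, x, ?_, mem_frontier_hemisphere_iff.2 e⟩
    rw [hW.frontier_eq]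
    exact ⟨hx, notMem_interior_of_inner_eq_zero hsub e⟩

theorem IsConvexBody.isUnitBody {W : Set (Sph d)} (hW : IsConvexBody W) :
    IsUnitBody (Subtype.val '' W : Set (EuclideanSpace ℝ (Fin (d + 1)))) where
  norm_eq := by rintro _ ⟨x, -, rfl⟩; exact norm_coe x
  compact := hW.closed.isCompact.image continuous_subtype_val
  nonempty := (hW.interior_nonempty.mono interior_subset).image _
  neg_notMem := by
    rintro _ ⟨x, hx, rfl⟩ ⟨y, hy, e⟩
    have : y = -x := Subtype.ext e
    exact hW.convex.1 x hx (this ▸ hy)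
  add_mem := by
    rintro _ ⟨a, ha, rfl⟩ _ ⟨b, hb, rfl⟩ s t hs ht h
    exact ⟨⟨_, mem_sphere_zero_iff_norm.2 h⟩, hW.convex.2 a ha b hb ⟨s, t, hs, ht, rfl⟩, rfl⟩
  exists_inner_ne := by
    intro k hk
    obtain ⟨x, hx⟩ := hW.interior_nonempty
    by_cases h : ⟪k, (x : EuclideanSpace ℝ (Fin (d + 1)))⟫ = 0
    · obtain ⟨t, ht, z, hz, r, hr, e⟩ := exists_mem_of_mem_nhds (mem_interior_iff_mem_nhds.1 hx) k
      refine ⟨z, ⟨z, hz, rfl⟩, ?_⟩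
      rw [e, real_inner_smul_right, inner_add_right, real_inner_smul_right, h,
        real_inner_self_eq_norm_sq]
      have := norm_pos_iff.2 hk
      positivity
    · exact ⟨x, ⟨x, interior_subset hx, rfl⟩, h⟩

/-- For `1 ≤ d` some `k ≠ 0` is orthogonal to a given `x` in `W`, while `W` is not contained in the
hyperplane orthogonal to `k`. -/
theorem IsConvexBody.nontrivial {W : Set (Sph d)} (hd : 1 ≤ d) (hW : IsConvexBody W) :
    (Subtype.val '' W : Set (EuclideanSpace ℝ (Fin (d + 1)))).Nontrivial := by
  have hU := hW.isUnitBody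
  obtain ⟨x, hx⟩ := hU.nonempty
  have : Fact (Module.finrank ℝ (EuclideanSpace ℝ (Fin (d + 1))) = d + 1) :=
    ⟨finrank_euclideanSpace_fin⟩
  have hfr : Module.finrank ℝ (ℝ ∙ x)ᗮ = d :=
    Submodule.finrank_orthogonal_span_singleton (hU.ne_zero hx)
  have : Nontrivial (ℝ ∙ x)ᗮ := Module.nontrivial_of_finrank_pos (R := ℝ) (by omega)
  obtain ⟨⟨k, hk⟩, hk0⟩ := exists_ne (0 : (ℝ ∙ x)ᗮ)
  obtain ⟨y, hy, hky⟩ := hU.exists_inner_ne k fun h => hk0 (Subtype.ext h)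
  refine ⟨x, hx, y, hy, ?_⟩
  rintro rfl
  rw [Submodule.mem_orthogonal_singleton_iff_inner_left] at hk
  exact hky hk

/-! ### Lunes, the centers of their faces and their thickness. -/

theorem mem_luneFace_iff {g h x : Sph d} :
    x ∈ luneFace g h ↔ ⟪(g : EuclideanSpace ℝ (Fin (d + 1))), x⟫ = 0 ∧
      0 ≤ ⟪(h : EuclideanSpace ℝ (Fin (d + 1))), x⟫ := by
  rw [luneFace, Set.mem_inter_iff, mem_frontier_hemisphere_iff, mem_hemisphere_iff]

theorem FormLune.inner_sq_lt_one {g h : Sph d} (hgh : FormLune g h) :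
    ⟪(h : EuclideanSpace ℝ (Fin (d + 1))), g⟫ ^ 2 < 1 := by
  refine SphericalConvex.inner_sq_lt_one (norm_coe h) (norm_coe g)
    (fun e => hgh.1 (Subtype.ext e.symm)) fun e => hgh.2 (Subtype.ext ?_)
  change (g : EuclideanSpace ℝ (Fin (d + 1))) = -(h : EuclideanSpace ℝ (Fin (d + 1)))
  rw [e, neg_neg]

theorem FormLune.symm {g h : Sph d} (hgh : FormLune g h) : FormLune h g :=
  ⟨hgh.1.symm, fun e => hgh.2 (by rw [e, neg_neg])⟩

/-- On the great sphere orthogonal to `g`, the vector `h` may be replaced by its projection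
orthogonal to `g`, whose normalization is the center. -/
theorem isSubhemisphereWithCenter_luneFace_iff {g h c : Sph d} (hgh : FormLune g h) :
    IsSubhemisphereWithCenter (luneFace g h) c ↔
      (c : EuclideanSpace ℝ (Fin (d + 1))) =
        ‖(h : EuclideanSpace ℝ (Fin (d + 1))) - ⟪(h : EuclideanSpace ℝ (Fin (d + 1))), g⟫ •
          (g : EuclideanSpace ℝ (Fin (d + 1)))‖⁻¹ •
        ((h : EuclideanSpace ℝ (Fin (d + 1))) - ⟪(h : EuclideanSpace ℝ (Fin (d + 1))), g⟫ •
          (g : EuclideanSpace ℝ (Fin (d + 1)))) := by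
  have hsq := hgh.inner_sq_lt_one
  have hN := norm_sub_smul_sq (norm_coe h) (norm_coe g)
  set z := (h : EuclideanSpace ℝ (Fin (d + 1))) - ⟪(h : EuclideanSpace ℝ (Fin (d + 1))), g⟫ •
    (g : EuclideanSpace ℝ (Fin (d + 1))) with hz
  have hz0 : z ≠ 0 := by intro h; rw [h, norm_zero] at hN; linarith
  have hNp : 0 < ‖z‖ := norm_pos_iff.2 hz0
  have hgz : ⟪(g : EuclideanSpace ℝ (Fin (d + 1))), z⟫ = 0 := by
    rw [hz, inner_sub_right, real_inner_smul_right, real_inner_self_eq_norm_sq, norm_coe,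
      real_inner_comm]
    ring
  have hhx : ∀ x : EuclideanSpace ℝ (Fin (d + 1)),
      ⟪(g : EuclideanSpace ℝ (Fin (d + 1))), x⟫ = 0 →
      ⟪‖z‖⁻¹ • z, x⟫ = ‖z‖⁻¹ * ⟪(h : EuclideanSpace ℝ (Fin (d + 1))), x⟫ := by
    intro x hx
    rw [real_inner_smul_left, hz, inner_sub_left, real_inner_smul_left, hx, mul_zero, sub_zero]
  constructor
  · rintro ⟨n, hn, hA⟩
    set a := ‖z‖⁻¹ • z with ha
    have ha1 : ‖a‖ = 1 := norm_inv_smul_self hz0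
    have hga : ⟪(g : EuclideanSpace ℝ (Fin (d + 1))), a⟫ = 0 := by
      rw [ha, real_inner_smul_right, hgz, mul_zero]
    have hmem : ∀ x : Sph d, x ∈ luneFace g h →
        0 ≤ ⟪(c : EuclideanSpace ℝ (Fin (d + 1))), x⟫ := by
      intro x hx
      rw [hA] at hx
      have := hx.2
      exact mem_hemisphere_iff.1 this
    have hc : c ∈ luneFace g h := by
      rw [hA]
      refine ⟨hn, mem_hemisphere_iff.2 ?_⟩
      rw [real_inner_self_eq_norm_sq]
      positivity
    rw [mem_luneFace_iff] at hc
    have hac : 0 ≤ ⟪a, (c : EuclideanSpace ℝ (Fin (d + 1)))⟫ := by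
      rw [hhx _ hc.1]
      exact mul_nonneg (by positivity) hc.2
    by_contra hne
    have hlt := SphericalConvex.inner_sq_lt_one ha1 (norm_coe c) (Ne.symm hne) fun e => by
      rw [e, inner_neg_left, real_inner_self_eq_norm_sq, norm_coe] at hac
      norm_num at hac
    -- This vector is orthogonal to `g` and `h`, so its normalization lies on the face, yet `⟪c, y⟫
    -- = ⟪a, c⟫ ^ 2 - 1 < 0` for a center `c ≠ a`.
    set y := ⟪a, (c : EuclideanSpace ℝ (Fin (d + 1)))⟫ • a -
      (c : EuclideanSpace ℝ (Fin (d + 1))) with hy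
    have hcy : ⟪(c : EuclideanSpace ℝ (Fin (d + 1))), y⟫ < 0 := by
      rw [hy, inner_sub_right, real_inner_smul_right, real_inner_self_eq_norm_sq, norm_coe,
        real_inner_comm a]
      nlinarith
    have hy0 : y ≠ 0 := by intro h; rw [h, inner_zero_right] at hcy; exact lt_irrefl _ hcy
    have hyp : 0 < ‖y‖⁻¹ := inv_pos.2 (norm_pos_iff.2 hy0)
    have hgy : ⟪(g : EuclideanSpace ℝ (Fin (d + 1))), y⟫ = 0 := by
      rw [hy, inner_sub_right, real_inner_smul_right, hga, hc.1]; ring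
    have hhy : ⟪(h : EuclideanSpace ℝ (Fin (d + 1))), y⟫ = 0 := by
      have h1 := hhx y hgy
      have h2 : ⟪a, y⟫ = 0 := by
        rw [hy, inner_sub_right, real_inner_smul_right, real_inner_self_eq_norm_sq, ha1]; ring
      rw [h2] at h1
      exact (mul_eq_zero.1 h1.symm).resolve_left (inv_ne_zero hNp.ne')
    have := hmem ⟨‖y‖⁻¹ • y, mem_sphere_zero_iff_norm.2 (norm_inv_smul_self hy0)⟩
      (mem_luneFace_iff.2 (by simp only [real_inner_smul_right, hgy, hhy, mul_zero]; simp))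
    simp only [real_inner_smul_right] at this
    nlinarith
  · intro e
    refine ⟨g, ?_, ?_⟩
    · rw [greatSphere, Set.mem_ofPred_eq, e, real_inner_smul_right, hgz, mul_zero]
    · ext x
      rw [mem_luneFace_iff]
      have hx : x ∈ {x | x ∈ greatSphere g ∧ sdist x c ≤ Real.pi / 2} ↔
          ⟪(g : EuclideanSpace ℝ (Fin (d + 1))), x⟫ = 0 ∧
            0 ≤ ⟪(c : EuclideanSpace ℝ (Fin (d + 1))), x⟫ :=
        and_congr Iff.rfl mem_hemisphere_iff
      rw [hx]
      refine and_congr_right fun h1 => ?_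
      rw [e, hhx _ h1, mul_nonneg_iff_of_pos_left (inv_pos.2 hNp)]

/-- The thickness of a lune is complementary to the distance of the centers of the hemispheres. -/
theorem isLuneThickness_iff {g h : Sph d} {t : ℝ} :
    IsLuneThickness g h t ↔ FormLune g h ∧
      t = Real.pi - Real.arccos ⟪(g : EuclideanSpace ℝ (Fin (d + 1))), h⟫ := by
  rw [IsLuneThickness]
  refine and_congr_right fun hgh => ?_
  have hsq := hgh.inner_sq_lt_one
  have h1 := norm_sub_smul_sq (norm_coe h) (norm_coe g)
  have h2 := norm_sub_smul_sq (norm_coe g) (norm_coe h)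
  have hcomm : ⟪(g : EuclideanSpace ℝ (Fin (d + 1))), (h : EuclideanSpace ℝ (Fin (d + 1)))⟫ =
    ⟪(h : EuclideanSpace ℝ (Fin (d + 1))), g⟫ := real_inner_comm _ _
  have hangle : ∀ a b : Sph d, IsSubhemisphereWithCenter (luneFace g h) a →
      IsSubhemisphereWithCenter (luneFace h g) b →
      sdist a b = Real.pi - Real.arccos ⟪(g : EuclideanSpace ℝ (Fin (d + 1))), h⟫ := by
    intro a b ha hb
    rw [isSubhemisphereWithCenter_luneFace_iff hgh] at ha
    rw [isSubhemisphereWithCenter_luneFace_iff hgh.symm] at hb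
    rw [sdist_eq_arccos, ← Real.arccos_neg]
    congr 1
    rw [hcomm] at hb h2 ⊢
    rw [ha, hb]
    have h3 := (pow_left_inj₀ (norm_nonneg _) (norm_nonneg _) two_ne_zero).1 (h2.trans h1.symm)
    rw [h3]
    have h4 : ‖(h : EuclideanSpace ℝ (Fin (d + 1))) - ⟪(h : EuclideanSpace ℝ (Fin (d + 1))), g⟫ •
          (g : EuclideanSpace ℝ (Fin (d + 1)))‖ ≠ 0 := by
      intro h; rw [h] at h1; norm_num at h1; linarith
    rw [real_inner_smul_left, real_inner_smul_right, inner_sub_left, inner_sub_right,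
      inner_sub_right, real_inner_smul_left, real_inner_smul_left, real_inner_smul_right,
      real_inner_smul_right, real_inner_self_eq_norm_sq, real_inner_self_eq_norm_sq, norm_coe,
      norm_coe, hcomm]
    field_simp
    rw [h1]; ring
  constructor
  · rintro ⟨a, b, ha, hb, rfl⟩
    exact hangle a b ha hb
  · rintro rfl
    have hne : ∀ {z : EuclideanSpace ℝ (Fin (d + 1))} {r : ℝ}, ‖z‖ ^ 2 = 1 - r ^ 2 → r ^ 2 < 1 →
        z ≠ 0 := by
      rintro z r hz hr rfl
      rw [norm_zero] at hz; linarith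
    let a : Sph d := ⟨_, mem_sphere_zero_iff_norm.2 (norm_inv_smul_self (hne h1 hsq))⟩
    let b : Sph d := ⟨_, mem_sphere_zero_iff_norm.2 (norm_inv_smul_self
      (hne h2 hgh.symm.inner_sq_lt_one))⟩
    have ha := (isSubhemisphereWithCenter_luneFace_iff (c := a) hgh).2 rfl
    have hb := (isSubhemisphereWithCenter_luneFace_iff (c := b) hgh.symm).2 rfl
    exact ⟨a, b, ha, hb, (hangle a b ha hb).symm⟩

/-! ### Constant width as a condition on the dual boundary, and the conclusion. -/

/-- Constant width of `W` means that the dual body has constant diameter at its boundary. -/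
theorem IsBodyOfConstantWidth.dual_constantDiameter {W : Set (Sph d)} {w : ℝ} (hd : 1 ≤ d)
    (hW : IsBodyOfConstantWidth W w) :
    0 ≤ w ∧ w ≤ Real.pi ∧
    (∀ k ∈ dualBoundary (Subtype.val '' W : Set (EuclideanSpace ℝ (Fin (d + 1)))),
      ∀ m ∈ dualBoundary (Subtype.val '' W : Set (EuclideanSpace ℝ (Fin (d + 1)))),
        -Real.cos w ≤ ⟪k, m⟫) ∧
    ∀ k ∈ dualBoundary (Subtype.val '' W : Set (EuclideanSpace ℝ (Fin (d + 1)))),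
      ∃ m ∈ dualBoundary (Subtype.val '' W : Set (EuclideanSpace ℝ (Fin (d + 1)))),
        ⟪k, m⟫ = -Real.cos w := by
  have hU := hW.1.isUnitBody
  have hnt := hW.1.nontrivial hd
  set V : Set (EuclideanSpace ℝ (Fin (d + 1))) := Subtype.val '' W with hV
  -- Only `m = k` has to be excluded: `m = -k` cannot occur, the dual body having no antipodes.
  have hset : ∀ k ∈ dualBoundary V, ∃ T : Set ℝ, sInf T = w ∧
      ∀ t, t ∈ T ↔ ∃ m ∈ dualBoundary V, m ≠ k ∧ t = Real.pi - Real.arccos ⟪k, m⟫ := by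
    intro k hk
    let k' : Sph d := ⟨k, mem_sphere_zero_iff_norm.2 hk.1.1⟩
    refine ⟨_, hW.2 k' ((supports_iff hW.1.closed).2 hk), fun t => ?_⟩
    constructor
    · rintro ⟨m, hm, ht⟩
      rw [isLuneThickness_iff] at ht
      exact ⟨m, (supports_iff hW.1.closed).1 hm, fun e => ht.1.1 (Subtype.ext e.symm), ht.2⟩
    · rintro ⟨m, hm, hmk, ht⟩
      let m' : Sph d := ⟨m, mem_sphere_zero_iff_norm.2 hm.1.1⟩
      refine ⟨m', (supports_iff hW.1.closed).2 hm, isLuneThickness_iff.2 ⟨⟨?_, ?_⟩, ht⟩⟩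
      · exact fun e => hmk (congrArg Subtype.val e).symm
      · intro e
        have e' : k = -m := congrArg Subtype.val e
        exact hU.neg_notMem_dualSet hm.1 (e' ▸ hk.1)
  have hne : ∀ k ∈ dualBoundary V, ∃ m ∈ dualBoundary V, m ≠ k :=
    fun k _ => hU.exists_ne_mem_dualBoundary hnt k
  obtain ⟨k₀, hk₀, -⟩ := hU.exists_ne_mem_dualBoundary hnt 0
  have hbdd : ∀ k ∈ dualBoundary V, ∀ T : Set ℝ,
      (∀ t, t ∈ T ↔ ∃ m ∈ dualBoundary V, m ≠ k ∧ t = Real.pi - Real.arccos ⟪k, m⟫) →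
      (∀ t ∈ T, 0 ≤ t ∧ t ≤ Real.pi) ∧ T.Nonempty := by
    intro k hk T hT
    constructor
    · intro t ht
      obtain ⟨m, -, -, rfl⟩ := (hT t).1 ht
      have h1 := Real.arccos_nonneg ⟪k, m⟫
      have h2 := Real.arccos_le_pi ⟪k, m⟫
      constructor <;> linarith
    · obtain ⟨m, hm, hmk⟩ := hne k hk
      exact ⟨_, (hT _).2 ⟨m, hm, hmk, rfl⟩⟩
  have hw : 0 ≤ w ∧ w ≤ Real.pi := by
    obtain ⟨T, rfl, hT⟩ := hset k₀ hk₀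
    obtain ⟨hb, t, ht⟩ := hbdd k₀ hk₀ T hT
    exact ⟨Real.sInf_nonneg fun t ht => (hb t ht).1,
      (csInf_le ⟨0, fun t ht => (hb t ht).1⟩ ht).trans (hb t ht).2⟩
  have hA : ∀ k ∈ dualBoundary V, ∀ m ∈ dualBoundary V, -Real.cos w ≤ ⟪k, m⟫ := by
    intro k hk m hm
    by_cases hmk : m = k
    · rw [hmk, real_inner_self_eq_norm_sq, hk.1.1]
      linarith [Real.neg_one_le_cos w]
    obtain ⟨T, e, hT⟩ := hset k hk
    obtain ⟨hb, -⟩ := hbdd k hk T hT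
    have h1 := csInf_le (⟨0, fun t ht => (hb t ht).1⟩ : BddBelow T)
      ((hT _).2 ⟨m, hm, hmk, rfl⟩)
    rw [e] at h1
    have h2 := Real.cos_le_cos_of_nonneg_of_le_pi (Real.arccos_nonneg ⟪k, m⟫)
      (by linarith [hw.1] : Real.pi - w ≤ Real.pi) (by linarith)
    have h3 := abs_le.1 (abs_inner_le_one hk.1.1 hm.1.1)
    rwa [Real.cos_pi_sub, Real.cos_arccos h3.1 h3.2] at h2
  refine ⟨hw.1, hw.2, hA, fun k hk => ?_⟩
  -- The case `m = k` needs no separate treatment: only `⟪k, m⟫ ≤ ⟪k, n⟫` for the competitors `n` is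
  -- used.
  obtain ⟨m, hm, hmin⟩ := hU.isCompact_dualBoundary.exists_isMinOn ⟨k, hk⟩
    (f := fun m => ⟪k, m⟫) (by fun_prop)
  refine ⟨m, hm, le_antisymm ?_ (hA k hk m hm)⟩
  obtain ⟨T, e, hT⟩ := hset k hk
  obtain ⟨-, hTne⟩ := hbdd k hk T hT
  have h1 : Real.pi - Real.arccos ⟪k, m⟫ ≤ w := by
    rw [← e]
    refine le_csInf hTne fun t ht => ?_
    obtain ⟨n, hn, -, rfl⟩ := (hT t).1 ht
    have h4 : ⟪k, m⟫ ≤ ⟪k, n⟫ := hmin hn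
    linarith [Real.arccos_le_arccos h4]
  have h2 := Real.cos_le_cos_of_nonneg_of_le_pi (by linarith [hw.2] : 0 ≤ Real.pi - w)
    (Real.arccos_le_pi ⟪k, m⟫) (by linarith)
  have h3 := abs_le.1 (abs_inner_le_one hk.1.1 hm.1.1)
  rwa [Real.cos_pi_sub, Real.cos_arccos h3.1 h3.2] at h2

end Sphere

end SphericalConvex

theorem mainTheorem9 (d : ℕ) (hd : 2 ≤ d) (W : Set (SphericalConvex.Sph d)) (w : ℝ)
    (hW : SphericalConvex.IsBodyOfConstantWidth W w) :
    SphericalConvex.sdiam W = w := by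
  obtain ⟨hw0, hwpi, hA, hB⟩ := hW.dual_constantDiameter (by omega)
  have hU := hW.1.isUnitBody
  have hnt := hW.1.nontrivial (by omega)
  refine IsGreatest.csSup_eq ⟨?_, ?_⟩
  · obtain ⟨_, ⟨x, hx, rfl⟩, _, ⟨y, hy, rfl⟩, e⟩ := hU.exists_inner_eq_neg hnt hA hB
    refine ⟨x, hx, y, hy, ?_⟩
    rw [SphericalConvex.sdist_eq_arccos, e, neg_neg, Real.arccos_cos hw0 hwpi]
  · rintro _ ⟨x, hx, y, hy, rfl⟩
    have h := hU.neg_le_inner hnt hA hB ⟨x, hx, rfl⟩ ⟨y, hy, rfl⟩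
    rw [neg_neg] at h
    rw [SphericalConvex.sdist_eq_arccos, ← Real.arccos_cos hw0 hwpi]
    exact Real.arccos_le_arccos h
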